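/- All graphs are finite and simple. A graph is $P_4$-sparse if every set of five vertices induces at most one chordless path $P_4$ on four vertices. For a graph $G$, a vertex $u$ of $G$ and a new vertex $w$, let $G+uw$ be $G$ together with $w$ and the single edge $uw$; write $\operatorname{fill}(G+uw)$ for the minimum number of further edges (so not counting $uw$) that have to be added to $G+uw$ to make it $P_4$-sparse. A spider is a graph whose vertex set is partitioned into sets $S,K,R$ ($R$ possibly empty) with $S$ independent, $K$ a clique, $|S|=|K|\ge 2$, every vertex of $R$ adjacent to all of $K$ and to none of $S$, and with a bijection $f:S\to K$ such that either $N(s)\cap K=\{f(s)\}$ for all $s\in S$ (thin spider), or $|K|\ge 3$ and $N(s)\cap K=K\setminus\{f(s)\}$ for all $s\in S$ (thick spider). The $P_4$-sparse tree of a $P_4$-sparse graph $G$ is the rooted tree whose leaves are the vertices of $G$, whose internal nodes have at least two children each and are labelled $0$, $1$ or $2$, where no $0$-node has a $0$-node as parent and no $1$-node has a $1$-node as parent, where two vertices whose least common ancestor is a $0$-node ($1$-node) are non-adjacent (adjacent), and where the leaves below each $2$-node induce a spider $(S,K,R)$, the children of the $2$-node being the leaves of $S\cup K$ and, if $R\neq\emptyset$,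 the root of one subtree with leaf set $R$. Let $G$ be a $P_4$-sparse graph, $u$ a vertex of $G$, and $t_0t_1\cdots t_hu$ the path in the $P_4$-sparse tree of $G$ from the root $t_0$ to the leaf $u$. For $0\le i\le h$ let $V_i$ be the set of leaves of the subtrees rooted at the children of $t_i$ other than the next node of the path. Suppose that the parent $t_h$ of $u$ is a $2$-node, corresponding to the spider $H=(S,K,R)$. Define $f_H$ as follows, where $f'=\operatorname{fill}(G[R]+uw)$ if $u\in R$. If $H$ is thin: - if $u\in S$, then $f_H=|K|-1$ if $R=\emptyset$, and $f_H=|K|$ otherwise; - if $u\in K$, then $f_H=|K|-1$; - if $u\in R$, then $f_H=\min\{\,|R\setminus N_G[u]|,\ |K|+f'\,\}$. If $H$ is thick: - if $u\in S$ and $|K|=3$, then $f_H=2$ if $R=\emptyset$, $f_H=3$ if $|R|=1$, and $f_H=4$ if $|R|\ge 2$; - if $u\in S$ and $|K|\ge 4$, then $f_H=|K|$ if $R=\emptyset$, and $f_H=|K|+1$ otherwise; - if $u\in K$, then $f_H=1$; - if $u\in R$, then $f_H=|K|+f'$. Then $\operatorname{fill}(G+uw)$ is at most the minimum of the two numbers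 (i) $f_H+|N_G(u)\cap(V_0\cup\cdots\cup V_{h-1})|$, and (ii) $\displaystyle\min_{0\le i\le h,\ t_i\text{ a }1\text{- or }2\text{-node}}\Bigl\{|N_G(u)\cap(V_0\cup\cdots\cup V_{i-1})|+|(V_i\cup\cdots\cup V_h)\setminus N_G(u)|\Bigr\}$. -/

import Mathlib

/-- The vertex set `Y` induces a chordless path on four vertices in `G`. -/
def InducesP4 {V : Type*} (G : SimpleGraph V) (Y : Set V) : Prop :=
  Nonempty (G.induce Y ≃g SimpleGraph.pathGraph 4)

/-- `G` is `P₄`-sparse: every set of five vertices induces at most one `P₄`. -/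
def IsP4Sparse {V : Type*} (G : SimpleGraph V) : Prop :=
  ∀ X : Set V, X.ncard = 5 → ∀ Y Z : Set V, Y ⊆ X → Z ⊆ X →
    InducesP4 G Y → InducesP4 G Z → Y = Z

/-- The graph `G + uw`: the new vertex `w` is `none`, and it is joined to `u` only. -/
def addTail {V : Type*} (G : SimpleGraph V) (u : V) : SimpleGraph (Option V) :=
  G.map Function.Embedding.some ⊔ SimpleGraph.edge (some u) none

/-- `n` is the number of fill edges of some `P₄`-sparse completion of `H`. -/
def IsFillCount {W : Type*} (H : SimpleGraph W) (n : ℕ) : Prop :=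
  ∃ F : SimpleGraph W, H ≤ F ∧ IsP4Sparse F ∧ (F.edgeSet \ H.edgeSet).ncard = n

/-- The number of fill edges in a minimum `P₄`-sparse completion of `H`. -/
noncomputable def minFill {W : Type*} (H : SimpleGraph W) : ℕ :=
  sInf {n | IsFillCount H n}

theorem isP4Sparse_top {W : Type*} : IsP4Sparse (⊤ : SimpleGraph W) := by
  rintro X - Y Z - - ⟨e⟩ -
  exfalso
  have h1 : (e.symm 0) ≠ (e.symm 2) := fun h => by
    have := e.symm.injective h
    revert this; decide
  have h2 : ((⊤ : SimpleGraph W).induce Y).Adj (e.symm 0) (e.symm 2) := by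
    simp [h1, -EmbeddingLike.apply_eq_iff_eq]
  rw [e.symm.map_adj_iff, SimpleGraph.pathGraph_adj] at h2
  revert h2; decide

/-- The minimum in `minFill` is attained by a completion. -/
theorem isFillCount_minFill {W : Type*} (H : SimpleGraph W) : IsFillCount H (minFill H) :=
  Nat.sInf_mem (s := {n | IsFillCount H n}) ⟨_, ⊤, le_top, isP4Sparse_top, rfl⟩

/-- What thin and thick spiders have in common: `S` is independent, `K` is a clique,
`|S| = |K| ≥ 2`, and each vertex of `R` sees all of `K` and nothing of `S`. -/
structure IsSpiderBase {V : Type*} (G : SimpleGraph V) (S K R : Set V) : Prop where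
  disjoint_SK : Disjoint S K
  disjoint_SR : Disjoint S R
  disjoint_KR : Disjoint K R
  indep : G.IsIndepSet S
  clique : G.IsClique K
  card_eq : S.ncard = K.ncard
  two_le : 2 ≤ K.ncard
  adj_RK : ∀ r ∈ R, ∀ k ∈ K, G.Adj r k
  not_adj_RS : ∀ r ∈ R, ∀ s ∈ S, ¬ G.Adj r s

/-- The subgraph of `G` induced by `S ∪ K ∪ R` is a thin spider with this partition. -/
def IsThinSpider {V : Type*} (G : SimpleGraph V) (S K R : Set V) : Prop :=
  IsSpiderBase G S K R ∧ ∃ f : S ≃ K, ∀ (s : S) (k : K), G.Adj s k ↔ k = f s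

/-- The subgraph of `G` induced by `S ∪ K ∪ R` is a thick spider with this partition
(`|K| ≥ 3`, since for `|K| = 2` the spider counts as thin). -/
def IsThickSpider {V : Type*} (G : SimpleGraph V) (S K R : Set V) : Prop :=
  IsSpiderBase G S K R ∧ 3 ≤ K.ncard ∧
    ∃ f : S ≃ K, ∀ (s : S) (k : K), G.Adj s k ↔ k ≠ f s

def IsSpider {V : Type*} (G : SimpleGraph V) (S K R : Set V) : Prop :=
  IsThinSpider G S K R ∨ IsThickSpider G S K R

/-- The number `f'` of fill edges in a minimum `P₄`-sparse completion of `G[R] + uw`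
(used only for `u ∈ R`). -/
noncomputable def bodyFill {V : Type*} (G : SimpleGraph V) (R : Set V) (u : V) : ℕ :=
  open Classical in
  if h : u ∈ R then minFill (addTail (G.induce R) ⟨u, h⟩) else 0

/-- The number of fill edges for a tail at the vertex `u` of a thin spider `(S, K, R)`. -/
noncomputable def thinTailValue {V : Type*} (G : SimpleGraph V) (S K R : Set V) (u : V) : ℕ :=
  open Classical in
  if u ∈ S then
    if R = ∅ then K.ncard - 1 else K.ncard
  else if u ∈ K then K.ncard - 1
  else min (R \ insert u (G.neighborSet u)).ncard (K.ncard + bodyFill G R u)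

/-- The number of fill edges for a tail at the vertex `u` of a thick spider `(S, K, R)`. -/
noncomputable def thickTailValue {V : Type*} (G : SimpleGraph V) (S K R : Set V) (u : V) : ℕ :=
  open Classical in
  if u ∈ S then
    if K.ncard = 3 then
      if R = ∅ then K.ncard - 1
      else if R.ncard = 1 then K.ncard
      else K.ncard + 1
    else
      if R = ∅ then K.ncard else K.ncard + 1
  else if u ∈ K then 1
  else K.ncard + bodyFill G R u

/-- The number of fill edges for a tail at the vertex `u` of a spider `(S, K, R)`. -/
noncomputable def spiderTailValue {V : Type*} (G : SimpleGraph V) (S K R : Set V) (u : V) : ℕ :=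
  open Classical in
  if IsThinSpider G S K R then thinTailValue G S K R u else thickTailValue G S K R u

/-- Labels `0`, `1`, `2` of the internal nodes of a `P₄`-sparse tree. -/
inductive NodeLabel
  | zero
  | one
  | two

/-- Rooted trees with leaves in `V` and labelled internal nodes; a tree stands for its root. -/
inductive LTree (V : Type*)
  | leaf (v : V) : LTree V
  | node (l : NodeLabel) (n : ℕ) (c : Fin n → LTree V) : LTree V

namespace LTree

/-- The list of the leaves of a tree, from left to right. -/
def leaves {V : Type*} : LTree V → List V
  | leaf v => [v]
  | node _ _ c => (List.ofFn fun i => leaves (c i)).flatten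

/-- The set of vertices associated with the leaves of a tree. -/
def verts {V : Type*} (t : LTree V) : Set V := {v | v ∈ t.leaves}

/-- `IsChild s t`: the root of `s` is a child of the root of `t`. -/
def IsChild {V : Type*} (s : LTree V) : LTree V → Prop
  | leaf _ => False
  | node _ _ c => ∃ i, c i = s

/-- `IsSubtree s t`: `s` is the subtree of `t` rooted at some node of `t`. -/
def IsSubtree {V : Type*} (s t : LTree V) : Prop := Relation.ReflTransGen IsChild s t

/-- The root of `t` is an internal node with label `l`. -/
def HasLabel {V : Type*} (t : LTree V) (l : NodeLabel) : Prop := ∃ n c, t = node l n c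

end LTree

/-- A `2`-node with children `c i` corresponds to the spider `(S, K, R)` of `G`: its children are
the leaves for the vertices of `S ∪ K` and, if `R` is non-empty, the root of a subtree for `R`. -/
structure IsSpiderNode {V : Type*} (G : SimpleGraph V) (t : LTree V) (S K R : Set V) : Prop where
  label : t.HasLabel NodeLabel.two
  spider : IsSpider G S K R
  leaf_child : ∀ v ∈ S ∪ K, (LTree.leaf v).IsChild t
  body_child : R.Nonempty → ∃ s : LTree V, s.IsChild t ∧ s.verts = R
  child : ∀ s : LTree V, s.IsChild t →
    (∃ v ∈ S ∪ K, s = LTree.leaf v) ∨ (R.Nonempty ∧ s.verts = R)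

/-- `T` is the `P₄`-sparse tree of `G`. The least common ancestor of two leaves is the node below
which they lie in the subtrees of two different children. -/
structure IsP4SparseTree {V : Type*} (G : SimpleGraph V) (T : LTree V) : Prop where
  leaves_nodup : T.leaves.Nodup
  mem_leaves : ∀ v : V, v ∈ T.leaves
  two_le_children : ∀ l n c, (LTree.node l n c).IsSubtree T → 2 ≤ n
  label_ne : ∀ s t : LTree V, t.IsSubtree T → s.IsChild t → ∀ l l' : NodeLabel,
    s.HasLabel l → t.HasLabel l' → l ≠ NodeLabel.two → l' ≠ l
  zero_node : ∀ n c, (LTree.node NodeLabel.zero n c).IsSubtree T → ∀ i j, i ≠ j →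
    ∀ x ∈ (c i).verts, ∀ y ∈ (c j).verts, ¬ G.Adj x y
  one_node : ∀ n c, (LTree.node NodeLabel.one n c).IsSubtree T → ∀ i j, i ≠ j →
    ∀ x ∈ (c i).verts, ∀ y ∈ (c j).verts, G.Adj x y
  two_node : ∀ t : LTree V, t.IsSubtree T → t.HasLabel NodeLabel.two →
    ∃ S K R, IsSpiderNode G t S K R

/-- `t 0, …, t h` and then the leaf for `u` form the path of `T` from its root to that leaf
(the values `t i` with `i > h + 1` are irrelevant). -/
structure IsRootPath {V : Type*} (T : LTree V) (u : V) (h : ℕ) (t : ℕ → LTree V) : Prop where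
  root : t 0 = T
  step : ∀ i ≤ h, (t (i + 1)).IsChild (t i)
  last : t (h + 1) = LTree.leaf u

/-- The set `V_i`: vertices of the subtrees rooted at the children of `t i` other than the next
node `t (i + 1)` of the path. -/
def sideSet {V : Type*} (t : ℕ → LTree V) (i : ℕ) : Set V :=
  {v | ∃ s : LTree V, s.IsChild (t i) ∧ s ≠ t (i + 1) ∧ v ∈ s.verts}

/-- `|N(u) ∩ (V_0 ∪ ⋯ ∪ V_{i-1})|`. -/
noncomputable def outerCost {V : Type*} (G : SimpleGraph V) (u : V) (t : ℕ → LTree V)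
    (i : ℕ) : ℕ :=
  (G.neighborSet u ∩ ⋃ j < i, sideSet t j).ncard

/-- `|(V_i ∪ ⋯ ∪ V_h) \ N(u)|`. -/
noncomputable def innerCost {V : Type*} (G : SimpleGraph V) (u : V) (t : ℕ → LTree V)
    (h i : ℕ) : ℕ :=
  ((⋃ j ∈ Set.Icc i h, sideSet t j) \ G.neighborSet u).ncard

/-!
Write `w` for the new vertex. In a `P₄`-sparse graph no induced `P₄` properly overlaps a module `M`
with at least two vertices: it would meet `M` in a single vertex, and exchanging that vertex inside
`M` would give two induced `P₄`s on five vertices. The leaves below each node `t i` of the root path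
form such a module. Hence a completion of `G[M] + uw` becomes one of `G + uw` as soon as `w` is
joined to the neighbours of `u` outside `M`, which makes `M` together with `w` a module; this costs
at most `outerCost G u t i`. It remains to complete `G[M] + uw`. For (ii), `u` is made universal in
`M`. For (i), where `M` is a spider, the completions combine three moves: making `u`, or the vertex
of `K` that the bijection assigns to it, universal; joining `w` to all of `K`, so that it enters the
body; turning `u` into a vertex of the clique whose foot is `w`.
-/

section InducedPaths

variable {V W : Type*} {G G' : SimpleGraph V} {H : SimpleGraph W} {A B Y : Set V}

theorem inducesP4_iff_exists_embedding :
    InducesP4 G Y ↔ ∃ f : SimpleGraph.pathGraph 4 ↪g G, Set.range f = Y := by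
  constructor
  · rintro ⟨e⟩
    refine ⟨(SimpleGraph.Embedding.induce Y).comp e.symm.toEmbedding, ?_⟩
    ext y
    exact ⟨fun ⟨i, hi⟩ => hi ▸ (e.symm i).2, fun hy => ⟨e ⟨y, hy⟩, by simp⟩⟩
  · rintro ⟨f, rfl⟩
    exact ⟨f.isoInduceRange.symm⟩

theorem InducesP4.ncard_eq (hY : InducesP4 G Y) : Y.ncard = 4 := by
  obtain ⟨f, rfl⟩ := inducesP4_iff_exists_embedding.1 hY
  rw [← Set.image_univ, Set.ncard_image_of_injective _ f.injective, Set.ncard_univ, Nat.card_fin]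

theorem InducesP4.finite (hY : InducesP4 G Y) : Y.Finite :=
  Set.finite_of_ncard_pos (by rw [hY.ncard_eq]; norm_num)

theorem InducesP4.image (hY : InducesP4 G Y) (f : G ↪g H) : InducesP4 H (f '' Y) := by
  obtain ⟨g, rfl⟩ := inducesP4_iff_exists_embedding.1 hY
  exact inducesP4_iff_exists_embedding.2 ⟨f.comp g, Set.range_comp f g⟩

theorem InducesP4.preimage_val (hY : InducesP4 G Y) (hA : Y ⊆ A) :
    InducesP4 (G.induce A) (Subtype.val ⁻¹' Y) := by
  obtain ⟨f, rfl⟩ := inducesP4_iff_exists_embedding.1 hY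
  refine inducesP4_iff_exists_embedding.2 ⟨⟨⟨fun i => ⟨f i, hA ⟨i, rfl⟩⟩, fun i j h => ?_⟩,
    f.map_adj_iff⟩, ?_⟩
  · exact f.injective (congrArg Subtype.val h)
  · ext x
    exact ⟨fun ⟨i, hi⟩ => ⟨i, congrArg Subtype.val hi⟩, fun ⟨i, hi⟩ => ⟨i, Subtype.ext hi⟩⟩

theorem InducesP4.congr (hY : InducesP4 G Y) (h : ∀ x ∈ Y, ∀ y ∈ Y, G.Adj x y ↔ G'.Adj x y) :
    InducesP4 G' Y := by
  have : G.induce Y = G'.induce Y := by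
    ext x y
    exact h x x.2 y y.2
  rwa [InducesP4, ← this]

theorem InducesP4.exists_adj (hY : InducesP4 G Y) : ∃ a b c d, Y = {a, b, c, d} ∧
    G.Adj a b ∧ G.Adj b c ∧ G.Adj c d ∧ ¬ G.Adj a c ∧ ¬ G.Adj b d ∧ ¬ G.Adj a d := by
  obtain ⟨f, rfl⟩ := inducesP4_iff_exists_embedding.1 hY
  refine ⟨f 0, f 1, f 2, f 3, ?_, ?_⟩
  · ext x
    simp only [Set.mem_range, Fin.exists_fin_succ, Set.mem_insert_iff, Set.mem_singleton_iff,
      eq_comm (a := x)]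
    simp
  · simp only [f.map_adj_iff, SimpleGraph.pathGraph_adj]
    decide

theorem isP4Sparse_iff : IsP4Sparse G ↔
    ∀ Y Z, InducesP4 G Y → InducesP4 G Z → (Y ∪ Z).ncard ≤ 5 → Y = Z := by
  refine ⟨fun hG Y Z hY hZ hcard => ?_, fun h X hX Y Z hYX hZX hY hZ => h Y Z hY hZ ?_⟩
  · have hYZ : (Y ∪ Z).ncard = 5 → Y = Z := fun h5 =>
      hG _ h5 Y Z Set.subset_union_left Set.subset_union_right hY hZ
    by_cases h4 : (Y ∪ Z).ncard ≤ 4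
    · have hfin := hY.finite.union hZ.finite
      rw [Set.eq_of_subset_of_ncard_le Set.subset_union_left (h4.trans hY.ncard_eq.ge) hfin]
      exact (Set.eq_of_subset_of_ncard_le Set.subset_union_right (h4.trans hZ.ncard_eq.ge)
        hfin).symm
    · exact hYZ (by omega)
  · rw [← hX]
    exact Set.ncard_le_ncard (Set.union_subset hYX hZX) (Set.finite_of_ncard_pos (by omega))

theorem isP4Sparse_induce_iff : IsP4Sparse (G.induce A) ↔
    ∀ Y ⊆ A, ∀ Z ⊆ A, InducesP4 G Y → InducesP4 G Z → (Y ∪ Z).ncard ≤ 5 → Y = Z := by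
  rw [isP4Sparse_iff]
  constructor
  · intro h Y hYA Z hZA hY hZ hcard
    have heq := h _ _ (hY.preimage_val hYA) (hZ.preimage_val hZA) ?_
    · rwa [Set.preimage_eq_preimage' (by simpa) (by simpa)] at heq
    · rwa [← Set.preimage_union, Set.ncard_preimage_of_injective_subset_range
        Subtype.val_injective (by simp [hYA, hZA])]
  · intro h Y Z hY hZ hcard
    let f := SimpleGraph.Embedding.induce (G := G) A
    refine f.injective.image_injective (h _ ?_ _ ?_ (hY.image f) (hZ.image f) ?_)
    · exact Subtype.coe_image_subset A Y
    · exact Subtype.coe_image_subset A Z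
    · rwa [← Set.image_union, Set.ncard_image_of_injective _ f.injective]

theorem IsP4Sparse.of_embedding (hH : IsP4Sparse H) (f : G ↪g H) : IsP4Sparse G := by
  refine isP4Sparse_iff.2 fun Y Z hY hZ hcard => f.injective.image_injective ?_
  refine isP4Sparse_iff.1 hH _ _ (hY.image f) (hZ.image f) ?_
  rwa [← Set.image_union, Set.ncard_image_of_injective _ f.injective]

theorem IsP4Sparse.induce_mono (hB : IsP4Sparse (G.induce B)) (hAB : A ⊆ B) :
    IsP4Sparse (G.induce A) :=
  hB.of_embedding (SimpleGraph.induceHomOfLE G hAB)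

theorem IsP4Sparse.induce_congr (hG : IsP4Sparse (G.induce A))
    (h : ∀ x ∈ A, ∀ y ∈ A, G.Adj x y ↔ G'.Adj x y) : IsP4Sparse (G'.induce A) := by
  have : G.induce A = G'.induce A := by
    ext x y
    exact h x x.2 y y.2
  rwa [← this]

end InducedPaths

section Sparse

variable {V : Type*} {G : SimpleGraph V} {A B S K R : Set V} {u w : V}

theorem isP4Sparse_induce_of_ncard_le_four (hfin : A.Finite) (hA : A.ncard ≤ 4) :
    IsP4Sparse (G.induce A) := by
  refine isP4Sparse_induce_iff.2 fun Y hYA Z hZA hY hZ _ => ?_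
  rw [Set.eq_of_subset_of_ncard_le hYA (hA.trans hY.ncard_eq.ge) hfin,
    Set.eq_of_subset_of_ncard_le hZA (hA.trans hZ.ncard_eq.ge) hfin]

theorem isP4Sparse_induce_union (hAB : Disjoint A B) (hA : IsP4Sparse (G.induce A))
    (hB : IsP4Sparse (G.induce B)) (h : ∀ Y ⊆ A ∪ B, InducesP4 G Y → Y ⊆ A ∨ Y ⊆ B) :
    IsP4Sparse (G.induce (A ∪ B)) := by
  refine isP4Sparse_induce_iff.2 fun Y hYAB Z hZAB hY hZ hcard => ?_
  have not_disjoint : ¬ Disjoint Y Z := fun hdisj => by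
    rw [Set.ncard_union_eq hdisj hY.finite hZ.finite, hY.ncard_eq, hZ.ncard_eq] at hcard
    omega
  rcases h Y hYAB hY with hYA | hYB <;> rcases h Z hZAB hZ with hZA | hZB
  · exact isP4Sparse_induce_iff.1 hA Y hYA Z hZA hY hZ hcard
  · exact absurd (hAB.mono hYA hZB) not_disjoint
  · exact absurd (hAB.symm.mono hYB hZA) not_disjoint
  · exact isP4Sparse_induce_iff.1 hB Y hYB Z hZB hY hZ hcard

theorem isP4Sparse_induce_union_of_not_adj (hAB : Disjoint A B) (hA : IsP4Sparse (G.induce A))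
    (hB : IsP4Sparse (G.induce B)) (h : ∀ a ∈ A, ∀ b ∈ B, ¬ G.Adj a b) :
    IsP4Sparse (G.induce (A ∪ B)) := by
  refine isP4Sparse_induce_union hAB hA hB fun Y hYAB hY => ?_
  obtain ⟨a, b, c, d, rfl, hab, hbc, hcd, -⟩ := hY.exists_adj
  simp only [Set.insert_subset_iff, Set.singleton_subset_iff, Set.mem_union] at hYAB ⊢
  grind [G.adj_comm]

/-- The Tyshkevich composition of the split graph on `S ∪ K` with the graph on `R`: what is left of
the definition of a spider when nothing is said about the edges between `S` and `K`. -/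
structure IsTyshkevichComposition (G : SimpleGraph V) (S K R : Set V) : Prop where
  disjoint_SK : Disjoint S K
  disjoint_SR : Disjoint S R
  disjoint_KR : Disjoint K R
  indep : G.IsIndepSet S
  clique : G.IsClique K
  adj_RK : ∀ r ∈ R, ∀ k ∈ K, G.Adj r k
  not_adj_RS : ∀ r ∈ R, ∀ s ∈ S, ¬ G.Adj r s

theorem IsSpiderBase.isTyshkevichComposition (h : IsSpiderBase G S K R) :
    IsTyshkevichComposition G S K R :=
  ⟨h.disjoint_SK, h.disjoint_SR, h.disjoint_KR, h.indep, h.clique, h.adj_RK, h.not_adj_RS⟩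

theorem IsTyshkevichComposition.isP4Sparse_induce (h : IsTyshkevichComposition G S K R)
    (hSK : IsP4Sparse (G.induce (S ∪ K))) (hR : IsP4Sparse (G.induce R)) :
    IsP4Sparse (G.induce (S ∪ K ∪ R)) := by
  refine isP4Sparse_induce_union (Set.disjoint_union_left.2 ⟨h.disjoint_SR, h.disjoint_KR⟩)
    hSK hR fun Y hY hP => ?_
  obtain ⟨a, b, c, d, rfl, hab, hbc, hcd, hac, hbd, had⟩ := hP.exists_adj
  have indep : ∀ x ∈ S, ∀ y ∈ S, ¬ G.Adj x y := fun x hx y hy hxy => h.indep hx hy hxy.ne hxy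
  have clique : ∀ x ∈ K, ∀ y ∈ K, x ≠ y → G.Adj x y := fun x hx y hy => h.clique hx hy
  have adj_RK := h.adj_RK
  have not_adj_RS := h.not_adj_RS
  simp only [Set.insert_subset_iff, Set.singleton_subset_iff, Set.mem_union] at hY ⊢
  grind [G.adj_comm, G.irrefl]

theorem isP4Sparse_induce_insert_of_adj (hA : IsP4Sparse (G.induce A))
    (h : ∀ x ∈ A, x ≠ w → G.Adj w x) : IsP4Sparse (G.induce (insert w A)) := by
  by_cases hw : w ∈ A
  · rwa [Set.insert_eq_of_mem hw]
  have comp : IsTyshkevichComposition G ∅ {w} A :=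
    ⟨by simp, by simp, by simpa, by simp, by simp,
      fun x hx k hk => hk ▸ (h x hx (ne_of_mem_of_not_mem hx hw)).symm, by simp⟩
  rw [show insert w A = ∅ ∪ {w} ∪ A by grind]
  exact comp.isP4Sparse_induce (isP4Sparse_induce_of_ncard_le_four (by simp) (by simp)) hA

theorem isP4Sparse_induce_union_of_between_subsingleton
    (hS : G.IsIndepSet S) (hK : G.IsClique K)
    (h : ∀ x, ((G.between S K).neighborSet x).Subsingleton) :
    IsP4Sparse (G.induce (S ∪ K)) := by
  have unique {x y z : V} (hxy : (G.between S K).Adj x y) (hxz : (G.between S K).Adj x z) :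
      y = z := h x hxy hxz
  have exists_partner {Y : Set V} (hYA : Y ⊆ S ∪ K) (hY : InducesP4 G Y) :
      ∀ y ∈ Y, ∃ z ∈ Y, (G.between S K).Adj y z := by
    obtain ⟨a, b, c, d, rfl, hab, hbc, hcd, hac, hbd, had⟩ := hY.exists_adj
    have indep : ∀ x ∈ S, ∀ y ∈ S, ¬ G.Adj x y := fun x hx y hy hxy => hS hx hy hxy.ne hxy
    have clique : ∀ x ∈ K, ∀ y ∈ K, x ≠ y → G.Adj x y := fun x hx y hy => hK hx hy
    simp only [Set.insert_subset_iff, Set.singleton_subset_iff, Set.mem_union] at hYA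
    simp only [SimpleGraph.between_adj, Set.mem_insert_iff, Set.mem_singleton_iff,
      forall_eq_or_imp, forall_eq, exists_eq_or_imp, exists_eq_left]
    grind [G.adj_comm, G.irrefl]
  refine isP4Sparse_induce_iff.2 fun Y hYA Z hZA hY hZ hcard => ?_
  by_contra hne
  obtain ⟨y, hyY, hyZ⟩ : ∃ y ∈ Y, y ∉ Z := Set.not_subset.1 fun hYZ =>
    hne (Set.eq_of_subset_of_ncard_le hYZ (hZ.ncard_eq.trans hY.ncard_eq.symm).le hZ.finite)
  obtain ⟨y', hy'Y, hyy'⟩ := exists_partner hYA hY y hyY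
  have hy'Z : y' ∉ Z := fun hy'Z => by
    obtain ⟨z, hzZ, hy'z⟩ := exists_partner hZA hZ y' hy'Z
    exact hyZ (unique hyy'.symm hy'z ▸ hzZ)
  have six_le : (insert y (insert y' Z)).ncard ≤ (Y ∪ Z).ncard :=
    Set.ncard_le_ncard (by grind) (hY.finite.union hZ.finite)
  rw [Set.ncard_insert_of_notMem (by simp [hyy'.ne, hyZ]) (hZ.finite.insert y'),
    Set.ncard_insert_of_notMem hy'Z hZ.finite, hZ.ncard_eq] at six_le
  omega

theorem IsTyshkevichComposition.insert_pendant (h : IsTyshkevichComposition G S K R)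
    (hu : u ∈ R) (huR : ∀ x ∈ R, x ≠ u → G.Adj u x) (hw : w ∉ S ∪ K ∪ R)
    (hwu : ∀ x ∈ S ∪ K ∪ R, G.Adj w x ↔ x = u) :
    IsTyshkevichComposition G (insert w S) (insert u K) (R \ {u}) := by
  have hSK := Set.disjoint_left.1 h.disjoint_SK
  have hSR := Set.disjoint_left.1 h.disjoint_SR
  have hKR := Set.disjoint_left.1 h.disjoint_KR
  have adj_RK := h.adj_RK
  have not_adj_RS := h.not_adj_RS
  refine ⟨?_, ?_, ?_, ?_, SimpleGraph.isClique_insert.2 ⟨h.clique, fun k hk _ => adj_RK u hu k hk⟩,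
    ?_, ?_⟩
  · rw [Set.disjoint_left]
    grind
  · rw [Set.disjoint_left]
    grind
  · rw [Set.disjoint_left]
    grind
  · refine Set.pairwise_insert.2 ⟨h.indep, fun x hx _ => ?_⟩
    grind [G.adj_comm]
  · grind [G.adj_comm]
  · grind [G.adj_comm]

theorem IsTyshkevichComposition.isP4Sparse_induce_insert (h : IsTyshkevichComposition G S K R)
    (hSK : ∀ x, ((G.between S K).neighborSet x).Subsingleton) (hR : IsP4Sparse (G.induce R))
    (hu : u ∈ R) (huR : ∀ x ∈ R, x ≠ u → G.Adj u x) (hw : w ∉ S ∪ K ∪ R)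
    (hwu : ∀ x ∈ S ∪ K ∪ R, G.Adj w x ↔ x = u) :
    IsP4Sparse (G.induce (insert w (S ∪ K ∪ R))) := by
  have comp := h.insert_pendant hu huR hw hwu
  have matching : ∀ x, ((G.between (insert w S) (insert u K)).neighborSet x).Subsingleton := by
    intro x y hxy z hxz
    have unique : (G.between S K).Adj x y → (G.between S K).Adj x z → y = z := (hSK x · ·)
    simp only [SimpleGraph.mem_neighborSet, SimpleGraph.between_adj] at hxy hxz unique
    have not_adj_RS := h.not_adj_RS u hu
    have hSR := Set.disjoint_left.1 h.disjoint_SR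
    have hKR := Set.disjoint_left.1 h.disjoint_KR
    grind [G.adj_comm]
  have hsparse := comp.isP4Sparse_induce
    (isP4Sparse_induce_union_of_between_subsingleton comp.indep comp.clique
      matching) (hR.induce_mono Set.sdiff_subset)
  rwa [show insert w S ∪ insert u K ∪ R \ {u} = insert w (S ∪ K ∪ R) by grind] at hsparse

end Sparse

section Modules

variable {V : Type*} {F G H : SimpleGraph V} {A B Y : Set V} {x y : V}

/-- A module of `G` in the sense of modular decomposition: no vertex outside `A` distinguishes two
vertices of `A`. -/
def IsGraphModule (G : SimpleGraph V) (A : Set V) : Prop :=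
  ∀ v ∉ A, ∀ x ∈ A, ∀ y ∈ A, G.Adj v x → G.Adj v y

theorem IsGraphModule.subset_or_inter_subsingleton (hA : IsGraphModule G A)
    (hY : InducesP4 G Y) : Y ⊆ A ∨ (Y ∩ A).Subsingleton := by
  obtain ⟨a, b, c, d, rfl, hab, hbc, hcd, hac, hbd, had⟩ := hY.exists_adj
  simp only [IsGraphModule] at hA
  simp only [Set.insert_subset_iff, Set.singleton_subset_iff, Set.Subsingleton, Set.mem_inter_iff,
    Set.mem_insert_iff, Set.mem_singleton_iff]
  grind [G.adj_comm]

theorem IsGraphModule.inducesP4_insert_diff (hA : IsGraphModule G A) (hY : InducesP4 G Y)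
    (hYA : Y ∩ A = {y}) (hx : x ∈ A) : InducesP4 G (insert x (Y \ {y})) := by
  obtain ⟨f, rfl⟩ := inducesP4_iff_exists_embedding.1 hY
  obtain ⟨⟨i, rfl⟩, hiA⟩ : y ∈ Set.range f ∩ A := hYA ▸ rfl
  have not_mem {j} (hj : j ≠ i) : f j ∉ A := fun hjA =>
    hj (f.injective (hYA.subset ⟨⟨j, rfl⟩, hjA⟩))
  have adj_iff {j} (hj : j ≠ i) : G.Adj (f j) x ↔ (SimpleGraph.pathGraph 4).Adj j i := by
    rw [← f.map_adj_iff]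
    exact ⟨hA _ (not_mem hj) _ hx _ hiA, hA _ (not_mem hj) _ hiA _ hx⟩
  have hinj : Function.Injective (Function.update f i x) := fun j k hjk => by
    grind [Function.update_apply, f.injective.eq_iff]
  refine inducesP4_iff_exists_embedding.2 ⟨⟨⟨Function.update f i x, hinj⟩, fun {j k} => ?_⟩, ?_⟩
  · change G.Adj (Function.update f i x j) (Function.update f i x k) ↔ _
    by_cases hj : j = i <;> by_cases hk : k = i <;>
      simp [*, G.adj_comm x, (SimpleGraph.pathGraph 4).adj_comm i]
  · ext v
    change (∃ j, Function.update f i x j = v) ↔ _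
    simp only [Set.mem_insert_iff, Set.mem_sdiff, Set.mem_range, Set.mem_singleton_iff]
    constructor
    · grind [Function.update_apply, f.injective.eq_iff]
    · rintro (rfl | ⟨⟨j, rfl⟩, hj⟩)
      · exact ⟨i, Function.update_self ..⟩
      · exact ⟨j, Function.update_of_ne (fun hji => hj (congrArg f hji)) ..⟩

theorem IsGraphModule.isP4Sparse (hA : IsGraphModule F A) (hFA : IsP4Sparse (F.induce A))
    (hB : IsP4Sparse (H.induce B)) (hAB : Aᶜ ⊆ B) (hne : (A ∩ B).Nontrivial)
    (h : ∀ x ∈ B, ∀ y ∈ B, x ∉ A ∨ y ∉ A → (F.Adj x y ↔ H.Adj x y)) : IsP4Sparse F := by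
  have hAc : IsP4Sparse (F.induce Aᶜ) :=
    (hB.induce_mono hAB).induce_congr fun x hx y hy => (h x (hAB hx) y (hAB hy) (.inl hx)).symm
  have subset_or (Y : Set V) (hY : InducesP4 F Y) : Y ⊆ A ∨ Y ⊆ Aᶜ := by
    refine (hA.subset_or_inter_subsingleton hY).imp_right fun hsub => ?_
    by_contra hYA
    obtain ⟨y, hyY, hyA⟩ := Set.not_subset.1 hYA
    have hYA : Y ∩ A = {y} := hsub.eq_singleton_of_mem ⟨hyY, not_not.1 hyA⟩
    have hP4 {x : V} (hx : x ∈ A ∩ B) : InducesP4 H (insert x (Y \ {y})) :=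
      (hA.inducesP4_insert_diff hY hYA hx.1).congr fun a ha b hb => by
        grind [F.irrefl, H.irrefl]
    obtain ⟨p, hp, q, hq, hpq⟩ := hne
    have hsubB {x : V} (hx : x ∈ A ∩ B) : insert x (Y \ {y}) ⊆ B := by grind
    have heq := isP4Sparse_induce_iff.1 hB _ (hsubB hp) _ (hsubB hq) (hP4 hp) (hP4 hq) ?_
    · grind
    · calc (insert p (Y \ {y}) ∪ insert q (Y \ {y})).ncard
          = (insert p (insert q (Y \ {y}))).ncard := by congr 1; grind
        _ ≤ (Y \ {y}).ncard + 1 + 1 :=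
          (Set.ncard_insert_le p _).trans (Nat.succ_le_succ (Set.ncard_insert_le q _))
        _ = 5 := by rw [Set.ncard_sdiff_singleton_add_one hyY hY.finite, hY.ncard_eq]
  have hsparse := isP4Sparse_induce_union disjoint_compl_right hFA hAc fun Y _ => subset_or Y
  rw [Set.union_compl_self] at hsparse
  exact hsparse.of_embedding (SimpleGraph.induceUnivIso F).symm.toEmbedding

end Modules

section Fill

variable {V W : Type*} {G : SimpleGraph V} {F H : SimpleGraph W} {A B M S K R : Set W}
  {k u w x y : W}

/-- `H` with `k` joined to all vertices of `A` other than `k` itself; all fill sets below are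
composed of such stars. -/
def addStar (H : SimpleGraph W) (k : W) (A : Set W) : SimpleGraph W :=
  H ⊔ (⊤ : SimpleGraph W).between {k} A

theorem addStar_adj :
    (addStar H k A).Adj x y ↔ H.Adj x y ∨ x ≠ y ∧ (x = k ∧ y ∈ A ∨ x ∈ A ∧ y = k) := by
  simp [addStar, SimpleGraph.between_adj]

theorem le_addStar : H ≤ addStar H k A := le_sup_left

theorem minFill_eq_zero (hH : IsP4Sparse H) : minFill H = 0 :=
  Nat.sInf_eq_zero.2 (.inl ⟨H, le_rfl, hH, by simp⟩)

variable [Finite W]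

theorem ncard_edgeSet_addStar_diff_le : ((addStar H k A).edgeSet \ H.edgeSet).ncard ≤ A.ncard := by
  have hsub : (addStar H k A).edgeSet \ H.edgeSet ⊆ (fun x => s(k, x)) '' A := by
    rintro ⟨x, y⟩ ⟨hxy, hH⟩
    rcases (addStar_adj.1 hxy).resolve_left hH with ⟨-, ⟨rfl, hy⟩ | ⟨hx, rfl⟩⟩
    · exact ⟨y, hy, rfl⟩
    · exact ⟨x, hx, Sym2.eq_swap⟩
  exact (Set.ncard_le_ncard hsub).trans (Set.ncard_image_le A.toFinite)

theorem minFill_le_of_isP4Sparse_comap (f : G ↪g H) (hHF : H ≤ F) (hF : IsP4Sparse (F.comap f)) :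
    minFill G ≤ (F.edgeSet \ H.edgeSet).ncard := by
  have hle : G ≤ F.comap f := fun x y hxy => hHF (f.map_adj_iff.2 hxy)
  refine (Nat.sInf_le (s := {n | IsFillCount G n}) ⟨F.comap f, hle, hF, rfl⟩).trans
    (Set.ncard_le_ncard_of_injOn (Sym2.map f) ?_ (Sym2.map.injective f.injective).injOn)
  rintro ⟨x, y⟩ ⟨hxy, hG⟩
  exact ⟨hxy, fun hH => hG (f.map_adj_iff.1 hH)⟩

theorem minFill_le_of_embedding (f : G ↪g H) : minFill G ≤ minFill H := by
  obtain ⟨F, hHF, hF, hcard⟩ := isFillCount_minFill H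
  rw [← hcard]
  exact minFill_le_of_isP4Sparse_comap f hHF
    (hF.of_embedding (SimpleGraph.Embedding.comap f.toEmbedding F))

theorem exists_isP4Sparse_induce (H : SimpleGraph W) (A : Set W) :
    ∃ F, H ≤ F ∧ IsP4Sparse (F.induce A) ∧
      (F.edgeSet \ H.edgeSet).ncard ≤ minFill (H.induce A) ∧
      ∀ x y, F.Adj x y → H.Adj x y ∨ x ∈ A ∧ y ∈ A := by
  obtain ⟨F₀, hle, hF₀, hcard⟩ := isFillCount_minFill (H.induce A)
  have adj_iff (x y : W) : (H ⊔ F₀.map (Function.Embedding.subtype _)).Adj x y ↔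
      H.Adj x y ∨ ∃ (hx : x ∈ A) (hy : y ∈ A), F₀.Adj ⟨x, hx⟩ ⟨y, hy⟩ := by
    simp only [SimpleGraph.sup_adj, SimpleGraph.map_adj]
    grind [Function.Embedding.subtype_apply]
  refine ⟨H ⊔ F₀.map (Function.Embedding.subtype _), le_sup_left, ?_, ?_, fun x y hxy => ?_⟩
  · suffices SimpleGraph.induce A (H ⊔ F₀.map (Function.Embedding.subtype _)) = F₀ by rwa [this]
    ext ⟨x, hx⟩ ⟨y, hy⟩
    rw [SimpleGraph.comap_adj]
    exact (adj_iff x y).trans ⟨fun hxy => hxy.elim (@hle ⟨x, hx⟩ ⟨y, hy⟩) fun h => h.2.2,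
      fun hxy => .inr ⟨hx, hy, hxy⟩⟩
  · have hsub : (H ⊔ F₀.map (Function.Embedding.subtype _)).edgeSet \ H.edgeSet ⊆
        Sym2.map Subtype.val '' (F₀.edgeSet \ (H.induce A).edgeSet) := by
      rintro ⟨x, y⟩ ⟨hxy, hH⟩
      obtain ⟨hx, hy, hxy⟩ := ((adj_iff x y).1 hxy).resolve_left hH
      exact ⟨s(⟨x, hx⟩, ⟨y, hy⟩), ⟨hxy, hH⟩, rfl⟩
    rw [← hcard]
    exact (Set.ncard_le_ncard hsub).trans (Set.ncard_image_le (Set.toFinite _))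
  · exact ((adj_iff x y).1 hxy).imp_right fun ⟨hx, hy, _⟩ => ⟨hx, hy⟩

theorem minFill_le_of_isP4Sparse_addStar (f : G ↪g H) (hHF : H ≤ F)
    (hF : IsP4Sparse ((addStar F k B).comap f)) :
    minFill G ≤ (F.edgeSet \ H.edgeSet).ncard + B.ncard := calc
  minFill G ≤ ((addStar F k B).edgeSet \ H.edgeSet).ncard :=
    minFill_le_of_isP4Sparse_comap f (hHF.trans le_addStar) hF
  _ ≤ ((F.edgeSet \ H.edgeSet) ∪ ((addStar F k B).edgeSet \ F.edgeSet)).ncard :=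
    Set.ncard_le_ncard (by grind)
  _ ≤ (F.edgeSet \ H.edgeSet).ncard + B.ncard :=
    (Set.ncard_union_le _ _).trans (Nat.add_le_add_left ncard_edgeSet_addStar_diff_le _)

theorem minFill_induce_le_of_isP4Sparse_addStar (hF : IsP4Sparse ((addStar H k B).induce A)) :
    minFill (H.induce A) ≤ B.ncard := by
  simpa using minFill_le_of_isP4Sparse_addStar (.induce A) le_rfl hF

theorem minFill_induce_insert_le (H : SimpleGraph W) (hk : k ∉ A) :
    minFill (H.induce (insert k A)) ≤ minFill (H.induce A) + (A \ H.neighborSet k).ncard := by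
  obtain ⟨F, hHF, hF, hcard, -⟩ := exists_isP4Sparse_induce H A
  refine (minFill_le_of_isP4Sparse_addStar (.induce _) hHF (k := k) (B := A \ H.neighborSet k)
    ?_).trans (Nat.add_le_add_right hcard _)
  refine isP4Sparse_induce_insert_of_adj (hF.induce_congr fun x hx y hy => ?_) fun x hx hxk => ?_
  · rw [addStar_adj]
    grind
  · rw [addStar_adj]
    grind [SimpleGraph.mem_neighborSet, @hHF k x]

theorem IsTyshkevichComposition.minFill_induce_insert_le (h : IsTyshkevichComposition H S K R)
    (hSK : IsP4Sparse (H.induce (S ∪ K))) (hw : w ∉ S ∪ K ∪ R) (hwS : ∀ s ∈ S, ¬ H.Adj w s) :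
    minFill (H.induce (insert w (S ∪ K ∪ R))) ≤ K.ncard + minFill (H.induce (insert w R)) := by
  obtain ⟨F, hHF, hF, hcard, hFA⟩ := exists_isP4Sparse_induce H (insert w R)
  have hFH {x y : W} (hx : x ∉ insert w R) : F.Adj x y ↔ H.Adj x y :=
    ⟨fun hxy => (hFA x y hxy).resolve_right fun h => hx h.1, @hHF x y⟩
  have hSK' := Set.disjoint_left.1 h.disjoint_SK
  have hSR := Set.disjoint_left.1 h.disjoint_SR
  have hKR := Set.disjoint_left.1 h.disjoint_KR
  have comp : IsTyshkevichComposition (addStar F w K) S K (insert w R) := by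
    refine ⟨h.disjoint_SK, ?_, ?_, fun x hx y hy hxy => ?_,
      h.clique.mono (hHF.trans le_addStar), fun r hr k hk => ?_, fun r hr s hs => ?_⟩
    · rw [Set.disjoint_left]
      grind
    · rw [Set.disjoint_left]
      grind
    · have not_adj : ¬ H.Adj x y := h.indep hx hy hxy
      change ¬ (addStar F w K).Adj x y
      rw [addStar_adj, hFH (by grind)]
      grind
    · rw [addStar_adj]
      grind [h.adj_RK, @hHF r k]
    · rw [SimpleGraph.adj_comm, addStar_adj, hFH (by grind), H.adj_comm]
      grind [h.not_adj_RS]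
  rw [add_comm, show insert w (S ∪ K ∪ R) = S ∪ K ∪ insert w R by grind]
  refine (minFill_le_of_isP4Sparse_addStar (.induce _) hHF
    (comp.isP4Sparse_induce ?_ ?_)).trans (Nat.add_le_add_right hcard _)
  · refine hSK.induce_congr fun x hx y hy => ?_
    rw [addStar_adj, hFH (by grind)]
    grind
  · refine hF.induce_congr fun x hx y hy => ?_
    rw [addStar_adj]
    grind

theorem minFill_induce_insert_le_of_pendant (hM : IsP4Sparse (H.induce M)) (hu : u ∈ M)
    (hw : w ∉ M) (hwu : ∀ x ∈ M, H.Adj w x ↔ x = u) :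
    minFill (H.induce (insert w M)) ≤ (M \ insert u (H.neighborSet u)).ncard := by
  have hsparse : IsP4Sparse (H.induce ({w} ∪ M \ {u})) :=
    isP4Sparse_induce_union_of_not_adj (by grind)
      (isP4Sparse_induce_of_ncard_le_four (by simp) (by simp)) (hM.induce_mono Set.sdiff_subset)
      (by grind)
  rw [show insert w M = insert u ({w} ∪ M \ {u}) by grind]
  refine (minFill_induce_insert_le H (by grind)).trans ?_
  rw [minFill_eq_zero hsparse, zero_add]
  exact Set.ncard_le_ncard (by grind [SimpleGraph.mem_neighborSet, H.adj_comm])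

end Fill

section Tail

variable {V : Type*} {G : SimpleGraph V} {M R : Set V} {u x y : V}

theorem addTail_adj_some_some : (addTail G u).Adj (some x) (some y) ↔ G.Adj x y := by
  rw [addTail, SimpleGraph.sup_adj, SimpleGraph.map_adj]
  simp [SimpleGraph.edge_adj]

theorem addTail_adj_none_some : (addTail G u).Adj none (some x) ↔ x = u := by
  rw [addTail, SimpleGraph.sup_adj, SimpleGraph.map_adj]
  simp [SimpleGraph.edge_adj, eq_comm]

/-- The inclusion of `G` into `G + uw`. -/
def someEmbedding (G : SimpleGraph V) (u : V) : G ↪g addTail G u :=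
  ⟨Function.Embedding.some, addTail_adj_some_some⟩

theorem minFill_induce_tail_le_bodyFill [Finite V] (hu : u ∈ R) :
    minFill ((addTail G u).induce (insert none (some '' R))) ≤ bodyFill G R u := by
  let f : addTail (G.induce R) ⟨u, hu⟩ ↪g addTail G u :=
    ⟨(Function.Embedding.subtype _).optionMap, by
      rintro (_ | x) (_ | y) <;> simp [addTail_adj_some_some, addTail_adj_none_some,
        SimpleGraph.adj_comm _ _ none, Subtype.ext_iff]⟩
  have hrange : Set.range f = insert none (some '' R) := by
    ext (_ | x)
    · exact ⟨fun _ => .inl rfl, fun _ => ⟨none, rfl⟩⟩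
    · change (∃ y, Option.map Subtype.val y = some x) ↔ _
      rw [exists_congr fun y => Option.map_eq_some_iff]
      simp
  rw [bodyFill, dif_pos hu, ← hrange]
  exact minFill_le_of_embedding f.isoInduceRange.symm.toEmbedding

theorem IsP4Sparse.induce_image_some (hG : IsP4Sparse G) (u : V) (M : Set V) :
    IsP4Sparse ((addTail G u).induce (some '' M)) :=
  (hG.of_embedding (someEmbedding G u).isoInduceRange.symm.toEmbedding).induce_mono
    (Set.image_subset_range _ M)

theorem addTail_adj_none_of_mem_image_some {z : Option V} (hz : z ∈ some '' M) :
    (addTail G u).Adj none z ↔ z = some u := by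
  obtain ⟨x, -, rfl⟩ := hz
  rw [addTail_adj_none_some, Option.some_inj]

theorem none_notMem_image_some : none ∉ some '' M := by
  rintro ⟨x, -, hx⟩
  exact Option.some_ne_none x hx

theorem ncard_image_some_diff_le [Finite V] :
    (some '' M \ insert (some u) ((addTail G u).neighborSet (some u))).ncard ≤
      (M \ insert u (G.neighborSet u)).ncard := by
  rw [← Set.ncard_image_of_injective (M \ _) (Option.some_injective V)]
  refine Set.ncard_le_ncard ?_
  rintro _ ⟨⟨x, hx, rfl⟩, hxu⟩
  exact ⟨x, ⟨hx, mt (Or.imp (congrArg some) addTail_adj_some_some.2) hxu⟩, rfl⟩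

theorem minFill_induce_tail_le [Finite V] (hG : IsP4Sparse G) (hu : u ∈ M) :
    minFill ((addTail G u).induce (insert none (some '' M))) ≤
      (M \ insert u (G.neighborSet u)).ncard :=
  (minFill_induce_insert_le_of_pendant (hG.induce_image_some u M) ⟨u, hu, rfl⟩
    none_notMem_image_some fun _ => addTail_adj_none_of_mem_image_some).trans
      ncard_image_some_diff_le

theorem IsGraphModule.insert_none {F : SimpleGraph (Option V)} (hM : IsGraphModule G M)
    (hu : u ∈ M) (hsome : ∀ x ∉ M, ∀ y ∈ M, F.Adj (some x) (some y) ↔ G.Adj x y)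
    (hnone : ∀ x ∉ M, F.Adj (some x) none ↔ G.Adj x u) :
    IsGraphModule F (insert none (some '' M)) := by
  rintro (_ | v) hv x hx y hy
  · exact absurd (.inl rfl) hv
  have hvM : v ∉ M := fun hvM => hv (.inr ⟨v, hvM, rfl⟩)
  have exists_twin : ∀ z ∈ insert none (some '' M), ∃ m ∈ M, F.Adj (some v) z ↔ G.Adj v m := by
    rintro z (rfl | ⟨m, hm, rfl⟩)
    · exact ⟨u, hu, hnone v hvM⟩
    · exact ⟨m, hm, hsome v hvM m hm⟩
  obtain ⟨m, hm, hvx⟩ := exists_twin x hx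
  obtain ⟨n, hn, hvy⟩ := exists_twin y hy
  rw [hvx, hvy]
  exact hM v hvM m hm n hn

theorem IsGraphModule.isP4Sparse_option {F : SimpleGraph (Option V)} (hM : IsGraphModule G M)
    (hG : IsP4Sparse G) (hne : M.Nontrivial) (hu : u ∈ M)
    (hF : IsP4Sparse (F.induce (insert none (some '' M))))
    (hsome : ∀ x y, x ∉ M ∨ y ∉ M → (F.Adj (some x) (some y) ↔ G.Adj x y))
    (hnone : ∀ x ∉ M, F.Adj (some x) none ↔ G.Adj x u) : IsP4Sparse F := by
  refine (hM.insert_none hu (fun x hx y _ => hsome x y (.inl hx)) hnone).isP4Sparse hF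
    (hG.induce_image_some u Set.univ) ?_ ?_ ?_
  · rintro (_ | x) hx
    · exact absurd (.inl rfl) hx
    · exact ⟨x, trivial, rfl⟩
  · refine (hne.image (Option.some_injective V)).mono fun z hz => ⟨.inr hz, ?_⟩
    exact Set.image_mono M.subset_univ hz
  · rintro _ ⟨x, -, rfl⟩ _ ⟨y, -, rfl⟩ hxy
    rw [addTail_adj_some_some]
    exact hsome x y (by simpa using hxy)

theorem IsGraphModule.minFill_addTail_le [Finite V] (hG : IsP4Sparse G) (hM : IsGraphModule G M)
    (hne : M.Nontrivial) (hu : u ∈ M) :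
    minFill (addTail G u) ≤ minFill ((addTail G u).induce (insert none (some '' M))) +
      (G.neighborSet u \ M).ncard := by
  obtain ⟨F, hHF, hF, hcard, hFM⟩ :=
    exists_isP4Sparse_induce (addTail G u) (insert none (some '' M))
  have hFG (x y : V) (h : x ∉ M ∨ y ∉ M) : F.Adj (some x) (some y) ↔ G.Adj x y := by
    rw [← addTail_adj_some_some (u := u)]
    exact ⟨fun hxy => (hFM _ _ hxy).resolve_right (by grind), @hHF _ _⟩
  have not_adj_none (x : V) (hx : x ∉ M) : ¬ F.Adj (some x) none := fun hadj => by
    rcases hFM _ _ hadj with hadj | ⟨hxM, -⟩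
    · exact hx (addTail_adj_none_some.1 hadj.symm ▸ hu)
    · simp [hx] at hxM
  rw [← Set.ncard_image_of_injective _ (Option.some_injective V)]
  refine (minFill_le_of_isP4Sparse_addStar .refl hHF (k := none) ?_).trans
    (Nat.add_le_add_right hcard _)
  change IsP4Sparse (addStar F none (some '' (G.neighborSet u \ M)))
  refine hM.isP4Sparse_option hG hne hu (hF.induce_congr fun x hx y hy => ?_)
    (fun x y hxy => by simp [addStar_adj, hFG x y hxy])
    (fun x hx => by simp [addStar_adj, not_adj_none x hx, hx, G.adj_comm])
  rw [addStar_adj]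
  grind

end Tail

section Spiders

variable {W : Type*} {H : SimpleGraph W} {S K R : Set W} {k s u w : W}

theorem IsThinSpider.exists_partner_of_mem_S (h : IsThinSpider H S K R) (hs : s ∈ S) :
    ∃ k ∈ K, (∀ x ∈ K, H.Adj s x ↔ x = k) ∧ ∀ x ∈ S, H.Adj x k ↔ x = s := by
  obtain ⟨-, f, hf⟩ := h
  refine ⟨f ⟨s, hs⟩, (f _).2, fun x hx => ?_, fun x hx => ?_⟩
  · simpa [Subtype.ext_iff] using hf ⟨s, hs⟩ ⟨x, hx⟩
  · simpa [eq_comm, Subtype.ext_iff] using hf ⟨x, hx⟩ (f ⟨s, hs⟩)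

theorem IsThinSpider.exists_partner_of_mem_K (h : IsThinSpider H S K R) (hk : k ∈ K) :
    ∃ s ∈ S, (∀ x ∈ K, H.Adj s x ↔ x = k) ∧ ∀ x ∈ S, H.Adj x k ↔ x = s := by
  obtain ⟨-, f, hf⟩ := h
  obtain ⟨s, hs⟩ := f.surjective ⟨k, hk⟩
  refine ⟨s, s.2, fun x hx => ?_, fun x hx => (hf ⟨x, hx⟩ ⟨k, hk⟩).trans ?_⟩
  · simpa [hs, Subtype.ext_iff] using hf s ⟨x, hx⟩
  · rw [← hs, f.injective.eq_iff, eq_comm, Subtype.ext_iff]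

theorem IsThickSpider.exists_partner_of_mem_S (h : IsThickSpider H S K R) (hs : s ∈ S) :
    ∃ k ∈ K, (∀ x ∈ K, H.Adj s x ↔ x ≠ k) ∧ ∀ x ∈ S, H.Adj x k ↔ x ≠ s := by
  obtain ⟨-, -, f, hf⟩ := h
  refine ⟨f ⟨s, hs⟩, (f _).2, fun x hx => ?_, fun x hx => ?_⟩
  · simpa [Subtype.ext_iff] using hf ⟨s, hs⟩ ⟨x, hx⟩
  · simpa [eq_comm, Subtype.ext_iff] using hf ⟨x, hx⟩ (f ⟨s, hs⟩)

theorem IsThickSpider.exists_partner_of_mem_K (h : IsThickSpider H S K R) (hk : k ∈ K) :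
    ∃ s ∈ S, (∀ x ∈ K, H.Adj s x ↔ x ≠ k) ∧ ∀ x ∈ S, H.Adj x k ↔ x ≠ s := by
  obtain ⟨-, -, f, hf⟩ := h
  obtain ⟨s, hs⟩ := f.surjective ⟨k, hk⟩
  refine ⟨s, s.2, fun x hx => ?_, fun x hx => (hf ⟨x, hx⟩ ⟨k, hk⟩).trans ?_⟩
  · simpa [hs, Subtype.ext_iff] using hf s ⟨x, hx⟩
  · rw [← hs, f.injective.ne_iff, ne_comm, Ne, Subtype.ext_iff]

theorem IsThinSpider.between_subsingleton (h : IsThinSpider H S K R) (x : W) :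
    ((H.between S K).neighborSet x).Subsingleton := by
  intro y hy z hz
  simp only [SimpleGraph.mem_neighborSet, SimpleGraph.between_adj] at hy hz
  grind [H.adj_comm, h.exists_partner_of_mem_S, h.exists_partner_of_mem_K,
    Set.disjoint_left.1 h.1.disjoint_SK]

theorem IsThickSpider.isTyshkevichComposition_diff (h : IsThickSpider H S K R) (hu : u ∈ S)
    (hk : k ∈ K) (huk : ¬ H.Adj u k) :
    IsTyshkevichComposition H (S \ {u}) (K \ {k}) (insert u R) := by
  obtain ⟨l, -, huK, -⟩ := h.exists_partner_of_mem_S hu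
  have hSK := Set.disjoint_left.1 h.1.disjoint_SK
  have hSR := Set.disjoint_left.1 h.1.disjoint_SR
  have hKR := Set.disjoint_left.1 h.1.disjoint_KR
  have adj_RK := h.1.adj_RK
  have indep (x : W) (hx : x ∈ S) (hux : u ≠ x) : ¬ H.Adj u x := h.1.indep hu hx hux
  refine ⟨h.1.disjoint_SK.mono Set.sdiff_subset Set.sdiff_subset, ?_, ?_,
    h.1.indep.mono Set.sdiff_subset, h.1.clique.subset Set.sdiff_subset, by grind, ?_⟩
  · rw [Set.disjoint_left]
    grind
  · rw [Set.disjoint_left]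
    grind
  · grind [h.1.not_adj_RS]

theorem IsThickSpider.between_diff_subsingleton (h : IsThickSpider H S K R)
    (hK : K.ncard = 3) (hu : u ∈ S) (hk : k ∈ K) (huk : ¬ H.Adj u k) (x : W) :
    ((H.between (S \ {u}) (K \ {k})).neighborSet x).Subsingleton := by
  have hS' : (S \ {u}).ncard = 2 := by rw [Set.ncard_sdiff_singleton_of_mem hu, h.1.card_eq, hK]
  have hK' : (K \ {k}).ncard = 2 := by rw [Set.ncard_sdiff_singleton_of_mem hk, hK]
  obtain ⟨p, q, -, hS'⟩ := Set.ncard_eq_two.1 hS'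
  obtain ⟨a, b, -, hK'⟩ := Set.ncard_eq_two.1 hK'
  have exists_not_adj_of_mem_S (y : W) (hy : y ∈ S \ {u}) : ∃ z ∈ K \ {k}, ¬ H.Adj y z := by
    grind [h.exists_partner_of_mem_S, h.exists_partner_of_mem_K]
  have exists_not_adj_of_mem_K (z : W) (hz : z ∈ K \ {k}) : ∃ y ∈ S \ {u}, ¬ H.Adj y z := by
    grind [h.exists_partner_of_mem_S, h.exists_partner_of_mem_K]
  have hSK := Set.disjoint_left.1 h.1.disjoint_SK
  intro y hy z hz
  simp only [SimpleGraph.mem_neighborSet, SimpleGraph.between_adj] at hy hz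
  grind [H.adj_comm]

variable [Finite W]

theorem IsThinSpider.minFill_induce_insert_le_of_mem_K (h : IsThinSpider H S K R)
    (hsp : IsP4Sparse (H.induce (S ∪ K ∪ R))) (hw : w ∉ S ∪ K ∪ R)
    (hwu : ∀ x ∈ S ∪ K ∪ R, H.Adj w x ↔ x = u) (hu : u ∈ K) :
    minFill (H.induce (insert w (S ∪ K ∪ R))) ≤ K.ncard - 1 := by
  obtain ⟨s, hs, -, hadj⟩ := h.exists_partner_of_mem_K hu
  have hsub : (S ∪ K ∪ R) \ insert u (H.neighborSet u) ⊆ S \ {s} := by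
    have hclique (x : W) (hx : x ∈ K) (hxu : u ≠ x) : H.Adj u x := h.1.clique hu hx hxu
    grind [SimpleGraph.mem_neighborSet, H.adj_comm, h.1.adj_RK]
  calc _ ≤ ((S ∪ K ∪ R) \ insert u (H.neighborSet u)).ncard :=
        minFill_induce_insert_le_of_pendant hsp (.inl (.inr hu)) hw hwu
    _ ≤ (S \ {s}).ncard := Set.ncard_le_ncard hsub
    _ = K.ncard - 1 := by rw [Set.ncard_sdiff_singleton_of_mem hs, h.1.card_eq]

theorem IsThinSpider.minFill_induce_insert_le_of_mem_S (h : IsThinSpider H S K R)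
    (hsp : IsP4Sparse (H.induce (S ∪ K ∪ R))) (hw : w ∉ S ∪ K ∪ R)
    (hwu : ∀ x ∈ S ∪ K ∪ R, H.Adj w x ↔ x = u) (hu : u ∈ S) :
    minFill (H.induce (insert w (S ∪ K ∪ R))) ≤ K.ncard := by
  obtain ⟨k, hk, huK, hkS⟩ := h.exists_partner_of_mem_S hu
  have hSK := Set.disjoint_left.1 h.1.disjoint_SK
  have hsparse : IsP4Sparse (H.induce ({u, w} ∪ (S ∪ K ∪ R) \ {u, k})) := by
    refine isP4Sparse_induce_union_of_not_adj (by grind)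
      (isP4Sparse_induce_of_ncard_le_four (Set.toFinite _) ?_)
      (hsp.induce_mono Set.sdiff_subset) ?_
    · exact (Set.ncard_insert_le u {w}).trans (by simp)
    · have hindep (x : W) (hx : x ∈ S) (hux : u ≠ x) : ¬ H.Adj u x := h.1.indep hu hx hux
      grind [H.adj_comm, h.1.not_adj_RS]
  have hsub : ({u, w} ∪ (S ∪ K ∪ R) \ {u, k}) \ H.neighborSet k ⊆ insert w (S \ {u}) := by
    have hclique (x : W) (hx : x ∈ K) (hkx : k ≠ x) : H.Adj k x := h.1.clique hk hx hkx
    grind [SimpleGraph.mem_neighborSet, H.adj_comm, h.1.adj_RK]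
  rw [show insert w (S ∪ K ∪ R) = insert k ({u, w} ∪ (S ∪ K ∪ R) \ {u, k}) by grind]
  calc _ ≤ 0 + (({u, w} ∪ (S ∪ K ∪ R) \ {u, k}) \ H.neighborSet k).ncard := by
        rw [← minFill_eq_zero hsparse]
        exact minFill_induce_insert_le H (by grind)
    _ ≤ (insert w (S \ {u})).ncard := by
        rw [zero_add]
        exact Set.ncard_le_ncard hsub
    _ ≤ (S \ {u}).ncard + 1 := Set.ncard_insert_le _ _
    _ = K.ncard := by rw [Set.ncard_sdiff_singleton_add_one hu, h.1.card_eq]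

theorem IsThinSpider.minFill_induce_insert_union_le_of_mem_S (h : IsThinSpider H S K R)
    (hw : w ∉ S ∪ K) (hwu : ∀ x ∈ S ∪ K, H.Adj w x ↔ x = u) (hu : u ∈ S) :
    minFill (H.induce (insert w (S ∪ K))) ≤ K.ncard - 1 := by
  -- Once `u` sees all of `K`, it can trade its leg for `w`: `wu` and the other legs form a spider
  -- whose body is the partner `k` of `u`.
  obtain ⟨k, hk, huK, hkS⟩ := h.exists_partner_of_mem_S hu
  have hSK := Set.disjoint_left.1 h.1.disjoint_SK
  have indep (x : W) (hx : x ∈ S) (y : W) (hy : y ∈ S) : ¬ H.Adj x y :=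
    fun hxy => h.1.indep hx hy hxy.ne hxy
  have clique (x : W) (hx : x ∈ K) (y : W) (hy : y ∈ K) (hxy : x ≠ y) : H.Adj x y :=
    h.1.clique hx hy hxy
  have comp : IsTyshkevichComposition (addStar H u (K \ {k})) (S \ {u}) (K \ {k}) {u, k} := by
    refine ⟨h.1.disjoint_SK.mono Set.sdiff_subset Set.sdiff_subset, ?_, ?_, ?_, ?_, ?_, ?_⟩
    · rw [Set.disjoint_left]
      grind
    · rw [Set.disjoint_left]
      grind
    · intro x hx y hy _
      rw [addStar_adj]
      grind
    · exact (h.1.clique.mono le_addStar).subset Set.sdiff_subset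
    · intro x hx y hy
      rw [addStar_adj]
      grind
    · intro x hx y hy
      rw [addStar_adj]
      grind [H.adj_comm]
  have matching (x : W) :
      (((addStar H u (K \ {k})).between (S \ {u}) (K \ {k})).neighborSet x).Subsingleton := by
    refine (h.between_subsingleton x).anti fun y hxy => ?_
    simp only [SimpleGraph.mem_neighborSet, SimpleGraph.between_adj, addStar_adj] at hxy ⊢
    grind
  have hsparse := comp.isP4Sparse_induce_insert (w := w) matching
    (isP4Sparse_induce_of_ncard_le_four (Set.toFinite _)
      ((Set.ncard_insert_le u {k}).trans (by simp)))
    (.inl rfl) (by grind [addStar_adj]) (by grind) (by grind [addStar_adj])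
  rw [← Set.ncard_sdiff_singleton_of_mem hk]
  refine minFill_induce_le_of_isP4Sparse_addStar (k := u) ?_
  rwa [show S \ {u} ∪ K \ {k} ∪ {u, k} = S ∪ K by grind] at hsparse

theorem IsTyshkevichComposition.minFill_induce_insert_le_of_between_subsingleton
    (h : IsTyshkevichComposition H S K R)
    (hSK : ∀ x, ((H.between S K).neighborSet x).Subsingleton) (hR : IsP4Sparse (H.induce R))
    (hw : w ∉ S ∪ K ∪ R) (hwu : ∀ x ∈ S ∪ K ∪ R, H.Adj w x ↔ x = u) (hu : u ∈ R) :
    minFill (H.induce (insert w (S ∪ K ∪ R))) ≤ (R \ insert u (H.neighborSet u)).ncard := by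
  refine minFill_induce_le_of_isP4Sparse_addStar (k := u) ?_
  have hSR := Set.disjoint_left.1 h.disjoint_SR
  have hKR := Set.disjoint_left.1 h.disjoint_KR
  have adj_iff {x y : W} (hx : x ∉ R) :
      (addStar H u (R \ insert u (H.neighborSet u))).Adj x y ↔ H.Adj x y := by
    rw [addStar_adj]
    grind
  have comp : IsTyshkevichComposition (addStar H u (R \ insert u (H.neighborSet u))) S K R := by
    refine ⟨h.disjoint_SK, h.disjoint_SR, h.disjoint_KR,
      fun x hx y hy hxy => mt (adj_iff (hSR hx)).1 (h.indep hx hy hxy),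
      h.clique.mono le_addStar, fun r hr k hk => le_addStar (h.adj_RK r hr k hk),
      fun r hr s hs => ?_⟩
    rw [SimpleGraph.adj_comm, adj_iff (hSR hs), H.adj_comm]
    exact h.not_adj_RS r hr s hs
  have star (x : W) (hx : x ∈ R) (hxu : x ≠ u) :
      (addStar H u (R \ insert u (H.neighborSet u))).Adj u x := by
    rw [addStar_adj]
    grind [SimpleGraph.mem_neighborSet]
  have hR' : IsP4Sparse ((addStar H u (R \ insert u (H.neighborSet u))).induce (R \ {u})) :=
    (hR.induce_mono Set.sdiff_subset).induce_congr (by grind [addStar_adj])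
  have hRsparse := isP4Sparse_induce_insert_of_adj hR' fun x hx => star x hx.1
  rw [Set.insert_sdiff_self_of_mem hu] at hRsparse
  refine comp.isP4Sparse_induce_insert (fun x => (hSK x).anti fun y hxy => ?_) hRsparse hu star hw
    fun x hx => by rw [adj_iff (by grind), hwu x hx]
  simp only [SimpleGraph.mem_neighborSet, SimpleGraph.between_adj] at hxy ⊢
  grind [SimpleGraph.adj_comm]

theorem IsThickSpider.minFill_induce_insert_le_of_mem_K (h : IsThickSpider H S K R)
    (hsp : IsP4Sparse (H.induce (S ∪ K ∪ R))) (hw : w ∉ S ∪ K ∪ R)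
    (hwu : ∀ x ∈ S ∪ K ∪ R, H.Adj w x ↔ x = u) (hu : u ∈ K) :
    minFill (H.induce (insert w (S ∪ K ∪ R))) ≤ 1 := by
  obtain ⟨s, -, -, hadj⟩ := h.exists_partner_of_mem_K hu
  have hsub : (S ∪ K ∪ R) \ insert u (H.neighborSet u) ⊆ {s} := by
    have hclique (x : W) (hx : x ∈ K) (hxu : u ≠ x) : H.Adj u x := h.1.clique hu hx hxu
    grind [SimpleGraph.mem_neighborSet, H.adj_comm, h.1.adj_RK]
  calc _ ≤ ((S ∪ K ∪ R) \ insert u (H.neighborSet u)).ncard :=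
        minFill_induce_insert_le_of_pendant hsp (.inl (.inr hu)) hw hwu
    _ ≤ 1 := (Set.ncard_le_ncard hsub).trans (by simp)

theorem IsThickSpider.minFill_induce_insert_union_le_of_mem_S (h : IsThickSpider H S K R)
    (hsp : IsP4Sparse (H.induce (S ∪ K))) (hw : w ∉ S ∪ K)
    (hwu : ∀ x ∈ S ∪ K, H.Adj w x ↔ x = u) (hu : u ∈ S) :
    minFill (H.induce (insert w (S ∪ K))) ≤ K.ncard := by
  obtain ⟨k, -, hadj, -⟩ := h.exists_partner_of_mem_S hu
  have hsub : (S ∪ K) \ insert u (H.neighborSet u) ⊆ insert k (S \ {u}) := by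
    grind [SimpleGraph.mem_neighborSet]
  calc _ ≤ ((S ∪ K) \ insert u (H.neighborSet u)).ncard :=
        minFill_induce_insert_le_of_pendant hsp (.inl hu) hw hwu
    _ ≤ (insert k (S \ {u})).ncard := Set.ncard_le_ncard hsub
    _ ≤ (S \ {u}).ncard + 1 := Set.ncard_insert_le _ _
    _ = K.ncard := by rw [Set.ncard_sdiff_singleton_add_one hu, h.1.card_eq]

theorem IsThickSpider.minFill_induce_insert_le_add_two (h : IsThickSpider H S K R)
    (hw : w ∉ S ∪ K ∪ R) (hu : u ∈ S) (hk : k ∈ K) (huk : ¬ H.Adj u k) :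
    minFill (H.induce (insert w (S ∪ K ∪ R))) ≤
      minFill (H.induce (insert w (S \ {u} ∪ K \ {k} ∪ insert u R))) + 2 := by
  -- `k` is made universal: it sees all but `u` and `w`, and without it `u` belongs to the body.
  obtain ⟨s, -, -, hadj⟩ := h.exists_partner_of_mem_K hk
  have hSK := Set.disjoint_left.1 h.1.disjoint_SK
  have hKR := Set.disjoint_left.1 h.1.disjoint_KR
  have hclique (x : W) (hx : x ∈ K) (hkx : k ≠ x) : H.Adj k x := h.1.clique hk hx hkx
  have hsub : insert w (S \ {u} ∪ K \ {k} ∪ insert u R) \ H.neighborSet k ⊆ {u, w} := by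
    grind [SimpleGraph.mem_neighborSet, H.adj_comm, h.1.adj_RK]
  rw [show insert w (S ∪ K ∪ R) = insert k (insert w (S \ {u} ∪ K \ {k} ∪ insert u R)) by grind]
  refine (minFill_induce_insert_le H (by grind)).trans (Nat.add_le_add_left ?_ _)
  exact ((Set.ncard_le_ncard hsub).trans (Set.ncard_insert_le u {w})).trans (by simp)

theorem IsThickSpider.minFill_induce_insert_le_of_mem_S (h : IsThickSpider H S K R)
    (hsp : IsP4Sparse (H.induce (S ∪ K ∪ R))) (hw : w ∉ S ∪ K ∪ R)
    (hwu : ∀ x ∈ S ∪ K ∪ R, H.Adj w x ↔ x = u) (hu : u ∈ S) :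
    minFill (H.induce (insert w (S ∪ K ∪ R))) ≤ K.ncard + 1 := by
  obtain ⟨k, hk, huK, -⟩ := h.exists_partner_of_mem_S hu
  have huk : ¬ H.Adj u k := by simp [huK k hk]
  have comp := h.isTyshkevichComposition_diff hu hk huk
  have hbody : IsP4Sparse (H.induce (insert w (insert u R))) := by
    rw [show insert w (insert u R) = {u, w} ∪ R by grind]
    refine isP4Sparse_induce_union_of_not_adj ?_
      (isP4Sparse_induce_of_ncard_le_four (Set.toFinite _)
        ((Set.ncard_insert_le u {w}).trans (by simp)))
      (hsp.induce_mono Set.subset_union_right) ?_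
    · grind [Set.disjoint_left.1 h.1.disjoint_SR]
    · grind [Set.disjoint_left.1 h.1.disjoint_SR, h.1.not_adj_RS, H.adj_comm]
  have hle' := comp.minFill_induce_insert_le (w := w) (hsp.induce_mono (by grind)) (by grind)
    (by grind)
  rw [minFill_eq_zero hbody, Set.ncard_sdiff_singleton_of_mem hk] at hle'
  have hle := h.minFill_induce_insert_le_add_two hw hu hk huk
  have := h.1.two_le
  omega

theorem IsThickSpider.minFill_induce_insert_le_of_mem_S_of_ncard_eq_three
    (h : IsThickSpider H S K R) (hK : K.ncard = 3)
    (hsp : IsP4Sparse (H.induce (S ∪ K ∪ R))) (hw : w ∉ S ∪ K ∪ R)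
    (hwu : ∀ x ∈ S ∪ K ∪ R, H.Adj w x ↔ x = u) (hu : u ∈ S) :
    minFill (H.induce (insert w (S ∪ K ∪ R))) ≤ R.ncard + 2 := by
  obtain ⟨k, hk, huK, -⟩ := h.exists_partner_of_mem_S hu
  have huk : ¬ H.Adj u k := by simp [huK k hk]
  have comp := h.isTyshkevichComposition_diff hu hk huk
  have hbody : IsP4Sparse (H.induce (insert u R)) := hsp.induce_mono (by grind)
  calc _ ≤ minFill (H.induce (insert w (S \ {u} ∪ K \ {k} ∪ insert u R))) + 2 :=
        h.minFill_induce_insert_le_add_two hw hu hk huk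
    _ ≤ (insert u R \ insert u (H.neighborSet u)).ncard + 2 :=
        Nat.add_le_add_right (comp.minFill_induce_insert_le_of_between_subsingleton
          (h.between_diff_subsingleton hK hu hk huk) hbody (by grind) (by grind) (.inl rfl)) 2
    _ ≤ R.ncard + 2 := Nat.add_le_add_right (Set.ncard_le_ncard (by grind)) 2

end Spiders

section SpiderTails

variable {V W : Type*} {G : SimpleGraph V} {H : SimpleGraph W} {S K R : Set V} {u : V}

theorem IsSpiderBase.image (h : IsSpiderBase G S K R) (f : G ↪g H) :
    IsSpiderBase H (f '' S) (f '' K) (f '' R) where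
  disjoint_SK := (Set.disjoint_image_iff f.injective).2 h.disjoint_SK
  disjoint_SR := (Set.disjoint_image_iff f.injective).2 h.disjoint_SR
  disjoint_KR := (Set.disjoint_image_iff f.injective).2 h.disjoint_KR
  indep := by
    rintro _ ⟨x, hx, rfl⟩ _ ⟨y, hy, rfl⟩ hxy
    exact fun hadj => h.indep hx hy (ne_of_apply_ne f hxy) (f.map_adj_iff.1 hadj)
  clique := by
    rintro _ ⟨x, hx, rfl⟩ _ ⟨y, hy, rfl⟩ hxy
    exact f.map_adj_iff.2 (h.clique hx hy (ne_of_apply_ne f hxy))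
  card_eq := by simp only [Set.ncard_image_of_injective _ f.injective, h.card_eq]
  two_le := by simpa only [Set.ncard_image_of_injective _ f.injective] using h.two_le
  adj_RK := by
    rintro _ ⟨r, hr, rfl⟩ _ ⟨k, hk, rfl⟩
    exact f.map_adj_iff.2 (h.adj_RK r hr k hk)
  not_adj_RS := by
    rintro _ ⟨r, hr, rfl⟩ _ ⟨s, hs, rfl⟩
    exact mt f.map_adj_iff.1 (h.not_adj_RS r hr s hs)

theorem IsThinSpider.image (h : IsThinSpider G S K R) (f : G ↪g H) :
    IsThinSpider H (f '' S) (f '' K) (f '' R) := by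
  obtain ⟨hbase, e, he⟩ := h
  refine ⟨hbase.image f, (Equiv.Set.image f S f.injective).symm.trans
    (e.trans (Equiv.Set.image f K f.injective)), ?_⟩
  rw [(Equiv.Set.image f S f.injective).surjective.forall]
  rintro s ⟨_, k, hk, rfl⟩
  simpa [Subtype.ext_iff, f.injective.eq_iff] using he s ⟨k, hk⟩

theorem IsThickSpider.image (h : IsThickSpider G S K R) (f : G ↪g H) :
    IsThickSpider H (f '' S) (f '' K) (f '' R) := by
  obtain ⟨hbase, hthree, e, he⟩ := h
  refine ⟨hbase.image f, by rwa [Set.ncard_image_of_injective _ f.injective],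
    (Equiv.Set.image f S f.injective).symm.trans (e.trans (Equiv.Set.image f K f.injective)), ?_⟩
  rw [(Equiv.Set.image f S f.injective).surjective.forall]
  rintro s ⟨_, k, hk, rfl⟩
  simpa [Subtype.ext_iff, f.injective.eq_iff] using he s ⟨k, hk⟩

variable [Finite V]

theorem IsSpiderBase.minFill_induce_tail_le (hG : IsP4Sparse G) (h : IsSpiderBase G S K R)
    (hu : u ∈ R) : minFill ((addTail G u).induce (insert none (some '' (S ∪ K ∪ R)))) ≤
      K.ncard + bodyFill G R u := by
  have comp : IsTyshkevichComposition (addTail G u) (some '' S) (some '' K) (some '' R) :=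
    (h.image (someEmbedding G u)).isTyshkevichComposition
  have hle := comp.minFill_induce_insert_le (w := none) ?_ ?_ ?_
  · rw [Set.ncard_image_of_injective _ (Option.some_injective V)] at hle
    rw [Set.image_union, Set.image_union]
    exact hle.trans (Nat.add_le_add_left (minFill_induce_tail_le_bodyFill hu) _)
  · rw [← Set.image_union]
    exact hG.induce_image_some u _
  · simp only [← Set.image_union]
    exact none_notMem_image_some
  · rintro _ ⟨s, hs, rfl⟩ hadj
    have := addTail_adj_none_some.1 hadj
    exact Set.disjoint_left.1 h.disjoint_SR hs (this ▸ hu)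

theorem IsThinSpider.minFill_induce_tail_le (hG : IsP4Sparse G) (h : IsThinSpider G S K R)
    (hu : u ∈ S ∪ K ∪ R) :
    minFill ((addTail G u).induce (insert none (some '' (S ∪ K ∪ R)))) ≤
      thinTailValue G S K R u := by
  have h' : IsThinSpider (addTail G u) (some '' S) (some '' K) (some '' R) :=
    h.image (someEmbedding G u)
  have hsp := hG.induce_image_some u (S ∪ K ∪ R)
  have hw : none ∉ some '' (S ∪ K ∪ R) := none_notMem_image_some
  have hwu : ∀ x ∈ some '' (S ∪ K ∪ R), (addTail G u).Adj none x ↔ x = some u :=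
    fun x => addTail_adj_none_of_mem_image_some
  rw [thinTailValue]
  split_ifs with huS hR huK
  · subst hR
    rw [Set.union_empty, Set.image_union] at hw hwu ⊢
    rw [← Set.ncard_image_of_injective K (Option.some_injective V)]
    exact h'.minFill_induce_insert_union_le_of_mem_S hw hwu ⟨u, huS, rfl⟩
  · rw [Set.image_union, Set.image_union] at hsp hw hwu ⊢
    rw [← Set.ncard_image_of_injective K (Option.some_injective V)]
    exact h'.minFill_induce_insert_le_of_mem_S hsp hw hwu ⟨u, huS, rfl⟩
  · rw [Set.image_union, Set.image_union] at hsp hw hwu ⊢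
    rw [← Set.ncard_image_of_injective K (Option.some_injective V)]
    exact h'.minFill_induce_insert_le_of_mem_K hsp hw hwu ⟨u, huK, rfl⟩
  · have huR : u ∈ R := by grind
    refine le_min ?_ (h.1.minFill_induce_tail_le hG huR)
    rw [Set.image_union, Set.image_union] at hsp hw hwu ⊢
    exact (h'.1.isTyshkevichComposition.minFill_induce_insert_le_of_between_subsingleton
      h'.between_subsingleton (hG.induce_image_some u R) hw hwu ⟨u, huR, rfl⟩).trans
        ncard_image_some_diff_le

theorem IsThickSpider.minFill_induce_tail_le (hG : IsP4Sparse G) (h : IsThickSpider G S K R)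
    (hu : u ∈ S ∪ K ∪ R) :
    minFill ((addTail G u).induce (insert none (some '' (S ∪ K ∪ R)))) ≤
      thickTailValue G S K R u := by
  have h' : IsThickSpider (addTail G u) (some '' S) (some '' K) (some '' R) :=
    h.image (someEmbedding G u)
  have hsp := hG.induce_image_some u (S ∪ K ∪ R)
  have hw : none ∉ some '' (S ∪ K ∪ R) := none_notMem_image_some
  have hwu : ∀ x ∈ some '' (S ∪ K ∪ R), (addTail G u).Adj none x ↔ x = some u :=
    fun x => addTail_adj_none_of_mem_image_some
  have hthree (huS : u ∈ S) (hK : K.ncard = 3) :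
      minFill ((addTail G u).induce (insert none (some '' (S ∪ K ∪ R)))) ≤
        R.ncard + 2 := by
    rw [Set.image_union, Set.image_union] at hsp hw hwu ⊢
    rw [← Set.ncard_image_of_injective R (Option.some_injective V)]
    exact h'.minFill_induce_insert_le_of_mem_S_of_ncard_eq_three
      (by rwa [Set.ncard_image_of_injective K (Option.some_injective V)]) hsp hw hwu ⟨u, huS, rfl⟩
  have hsucc (huS : u ∈ S) :
      minFill ((addTail G u).induce (insert none (some '' (S ∪ K ∪ R)))) ≤
        K.ncard + 1 := by
    rw [Set.image_union, Set.image_union] at hsp hw hwu ⊢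
    rw [← Set.ncard_image_of_injective K (Option.some_injective V)]
    exact h'.minFill_induce_insert_le_of_mem_S hsp hw hwu ⟨u, huS, rfl⟩
  rw [thickTailValue]
  split_ifs with huS hK hR hR hR huK
  · simpa [hK, hR] using hthree huS hK
  · simpa [hK, hR] using hthree huS hK
  · exact hsucc huS
  · subst hR
    rw [Set.union_empty, Set.image_union] at hsp hw hwu ⊢
    rw [← Set.ncard_image_of_injective K (Option.some_injective V)]
    exact h'.minFill_induce_insert_union_le_of_mem_S hsp hw hwu ⟨u, huS, rfl⟩
  · exact hsucc huS
  · rw [Set.image_union, Set.image_union] at hsp hw hwu ⊢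
    exact h'.minFill_induce_insert_le_of_mem_K hsp hw hwu ⟨u, huK, rfl⟩
  · exact h.1.minFill_induce_tail_le hG (by grind)

theorem IsSpider.minFill_induce_tail_le (hG : IsP4Sparse G) (h : IsSpider G S K R)
    (hu : u ∈ S ∪ K ∪ R) :
    minFill ((addTail G u).induce (insert none (some '' (S ∪ K ∪ R)))) ≤
      spiderTailValue G S K R u := by
  rw [spiderTailValue]
  split_ifs with hthin
  · exact hthin.minFill_induce_tail_le hG hu
  · exact (h.resolve_left hthin).minFill_induce_tail_le hG hu

end SpiderTails

namespace LTree

variable {V : Type*} {s t : LTree V} {v : V}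

theorem verts_leaf (v : V) : (leaf v).verts = {v} := by
  simp [verts, leaves]

theorem mem_verts_node {l : NodeLabel} {n : ℕ} {c : Fin n → LTree V} :
    v ∈ (node l n c).verts ↔ ∃ i, v ∈ (c i).verts := by
  simp [verts, leaves, List.mem_ofFn]

theorem IsChild.verts_subset (hs : s.IsChild t) : s.verts ⊆ t.verts := by
  cases t with
  | leaf => exact hs.elim
  | node =>
    obtain ⟨i, rfl⟩ := hs
    exact fun v hv => mem_verts_node.2 ⟨i, hv⟩

theorem IsChild.exists_mem_verts (hs : s.IsChild t) (hv : v ∈ t.verts) :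
    ∃ s' : LTree V, s'.IsChild t ∧ v ∈ s'.verts := by
  cases t with
  | leaf => exact hs.elim
  | node l n c =>
    obtain ⟨i, hi⟩ := mem_verts_node.1 hv
    exact ⟨c i, ⟨i, rfl⟩, hi⟩

end LTree

section Trees

variable {V : Type*} {G : SimpleGraph V} {S K R : Set V} {T s t : LTree V}

theorem IsSpider.isSpiderBase (h : IsSpider G S K R) : IsSpiderBase G S K R :=
  h.elim And.left And.left

theorem IsSpiderNode.verts_eq (hN : IsSpiderNode G t S K R) (hs : s.IsChild t) :
    t.verts = S ∪ K ∪ R := by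
  refine Set.Subset.antisymm (fun v hv => ?_) (Set.union_subset (fun v hv => ?_) fun v hv => ?_)
  · obtain ⟨s', hs', hv⟩ := hs.exists_mem_verts hv
    rcases hN.child s' hs' with ⟨x, hx, rfl⟩ | ⟨-, hR⟩
    · rw [LTree.verts_leaf] at hv
      exact .inl (hv ▸ hx)
    · exact .inr (hR ▸ hv)
  · exact (hN.leaf_child v hv).verts_subset (by rw [LTree.verts_leaf, Set.mem_singleton_iff])
  · obtain ⟨s', hs', hR⟩ := hN.body_child ⟨v, hv⟩
    exact hs'.verts_subset (hR ▸ hv)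

theorem IsSpiderNode.adj_of_isChild (hN : IsSpiderNode G t S K R) (hs : s.IsChild t) :
    ∀ v ∈ t.verts \ s.verts, ∀ x ∈ s.verts, ∀ y ∈ s.verts, G.Adj v x → G.Adj v y := by
  rintro v ⟨hv, hvs⟩ x hx y hy hvx
  rw [hN.verts_eq hs] at hv
  rcases hN.child s hs with ⟨z, -, rfl⟩ | ⟨-, hR⟩
  · rw [LTree.verts_leaf] at hx hy
    rwa [hy, ← hx]
  · rw [hR] at hx hy hvs
    rcases hv with (hv | hv) | hv
    · exact absurd hvx.symm (hN.spider.isSpiderBase.not_adj_RS x hx v hv)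
    · exact (hN.spider.isSpiderBase.adj_RK y hy v hv).symm
    · exact absurd hv hvs

theorem IsP4SparseTree.adj_of_isChild (hT : IsP4SparseTree G T) (ht : t.IsSubtree T)
    (hs : s.IsChild t) :
    ∀ v ∈ t.verts \ s.verts, ∀ x ∈ s.verts, ∀ y ∈ s.verts, G.Adj v x → G.Adj v y := by
  rcases t with _ | ⟨l, n, c⟩
  · exact hs.elim
  have exists_ne : ∀ v ∈ (LTree.node l n c).verts \ s.verts,
      ∃ i j, s = c i ∧ j ≠ i ∧ v ∈ (c j).verts := by
    rintro v ⟨hv, hvs⟩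
    obtain ⟨i, rfl⟩ := hs
    obtain ⟨j, hj⟩ := LTree.mem_verts_node.1 hv
    exact ⟨i, j, rfl, fun hji => hvs (hji ▸ hj), hj⟩
  cases l with
  | zero =>
    intro v hv x hx y _ hvx
    obtain ⟨i, j, rfl, hji, hj⟩ := exists_ne v hv
    exact absurd hvx (hT.zero_node n c ht j i hji v hj x hx)
  | one =>
    intro v hv x _ y hy _
    obtain ⟨i, j, rfl, hji, hj⟩ := exists_ne v hv
    exact hT.one_node n c ht j i hji v hj y hy
  | two =>
    obtain ⟨S, K, R, hN⟩ := hT.two_node _ ht ⟨n, c, rfl⟩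
    exact hN.adj_of_isChild hs

end Trees

namespace IsRootPath

variable {V : Type*} {G : SimpleGraph V} {T : LTree V} {t : ℕ → LTree V} {u v : V} {h i j : ℕ}

theorem isSubtree (ht : IsRootPath T u h t) (hi : i ≤ h) : (t i).IsSubtree T := by
  induction i with
  | zero => exact ht.root ▸ .refl
  | succ i ih => exact (ih (by omega)).head (ht.step i (by omega))

theorem verts_subset (ht : IsRootPath T u h t) (hij : i ≤ j) (hj : j ≤ h + 1) :
    (t j).verts ⊆ (t i).verts := by
  induction j, hij using Nat.le_induction with
  | base => exact subset_rfl
  | succ j _ ih => exact (ht.step j (by omega)).verts_subset.trans (ih (by omega))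

theorem verts_zero (hT : IsP4SparseTree G T) (ht : IsRootPath T u h t) :
    (t 0).verts = Set.univ := by
  rw [ht.root]
  exact Set.eq_univ_of_forall hT.mem_leaves

theorem verts_last (ht : IsRootPath T u h t) : (t (h + 1)).verts = {u} := by
  rw [ht.last, LTree.verts_leaf]

theorem mem_verts (ht : IsRootPath T u h t) (hi : i ≤ h + 1) : u ∈ (t i).verts :=
  ht.verts_subset hi le_rfl (by rw [ht.verts_last, Set.mem_singleton_iff])

theorem exists_mem_sideSet (ht : IsRootPath T u h t) (hij : i ≤ j) (hj : j ≤ h + 1)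
    (hvi : v ∈ (t i).verts) (hvj : v ∉ (t j).verts) : ∃ k ∈ Set.Ico i j, v ∈ sideSet t k := by
  induction j, hij using Nat.le_induction with
  | base => exact absurd hvi hvj
  | succ j hij ih =>
    by_cases hv : v ∈ (t j).verts
    · obtain ⟨s, hs, hvs⟩ := (ht.step j (by omega)).exists_mem_verts hv
      exact ⟨j, ⟨hij, j.lt_succ_self⟩, s, hs, fun hst => hvj (hst ▸ hvs), hvs⟩
    · obtain ⟨k, hk, hvk⟩ := ih (by omega) hv
      exact ⟨k, Set.Ico_subset_Ico_right j.le_succ hk, hvk⟩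

theorem isGraphModule (hT : IsP4SparseTree G T) (ht : IsRootPath T u h t) (hi : i ≤ h) :
    IsGraphModule G (t i).verts := by
  induction i with
  | zero => exact fun v hv => absurd (ht.verts_zero hT ▸ Set.mem_univ v) hv
  | succ i ih =>
    intro v hv x hx y hy hvx
    have hchild := ht.step i (by omega)
    by_cases hvi : v ∈ (t i).verts
    · exact hT.adj_of_isChild (ht.isSubtree (by omega)) hchild v ⟨hvi, hv⟩ x hx y hy hvx
    · exact ih (by omega) v hvi x (hchild.verts_subset hx) y (hchild.verts_subset hy) hvx

theorem ncard_neighborSet_diff_le_outerCost [Finite V] (hT : IsP4SparseTree G T)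
    (ht : IsRootPath T u h t) (hi : i ≤ h) :
    (G.neighborSet u \ (t i).verts).ncard ≤ outerCost G u t i := by
  refine Set.ncard_le_ncard fun v ⟨hv, hvi⟩ => ⟨hv, ?_⟩
  obtain ⟨k, hk, hvk⟩ := ht.exists_mem_sideSet i.zero_le (by omega)
    (ht.verts_zero hT ▸ Set.mem_univ v) hvi
  exact Set.mem_iUnion₂.2 ⟨k, hk.2, hvk⟩

theorem ncard_verts_diff_le_innerCost [Finite V] (ht : IsRootPath T u h t) (hi : i ≤ h) :
    ((t i).verts \ insert u (G.neighborSet u)).ncard ≤ innerCost G u t h i := by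
  refine Set.ncard_le_ncard fun v ⟨hv, hvu⟩ => ⟨?_, fun hadj => hvu (.inr hadj)⟩
  have hvlast : v ∉ (t (h + 1)).verts := by
    rw [ht.verts_last]
    exact fun hv => hvu (.inl hv)
  obtain ⟨k, hk, hvk⟩ := ht.exists_mem_sideSet (by omega) le_rfl hv hvlast
  exact Set.mem_iUnion₂.2 ⟨k, ⟨hk.1, Nat.le_of_lt_succ hk.2⟩, hvk⟩

theorem minFill_addTail_le [Finite V] (hG : IsP4Sparse G) (hT : IsP4SparseTree G T)
    (ht : IsRootPath T u h t) (hi : i ≤ h) (hne : (t i).verts.Nontrivial) :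
    minFill (addTail G u) ≤
      minFill ((addTail G u).induce (insert none (some '' (t i).verts))) +
        outerCost G u t i :=
  ((ht.isGraphModule hT hi).minFill_addTail_le hG hne (ht.mem_verts (by omega))).trans
    (Nat.add_le_add_left (ht.ncard_neighborSet_diff_le_outerCost hT hi) _)

theorem minFill_induce_tail_le_innerCost [Finite V] (hG : IsP4Sparse G) (ht : IsRootPath T u h t)
    (hi : i ≤ h) :
    minFill ((addTail G u).induce (insert none (some '' (t i).verts))) ≤
      innerCost G u t h i :=
  (minFill_induce_tail_le hG (ht.mem_verts (by omega))).trans (ht.ncard_verts_diff_le_innerCost hi)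

end IsRootPath

theorem corollary1 {V : Type*} [Finite V] (G : SimpleGraph V) (hG : IsP4Sparse G)
    (T : LTree V) (hT : IsP4SparseTree G T)
    (u : V) (h : ℕ) (t : ℕ → LTree V) (ht : IsRootPath T u h t)
    (S K R : Set V) (hH : IsSpiderNode G (t h) S K R) :
    minFill (addTail G u) ≤
      min (spiderTailValue G S K R u + outerCost G u t h)
        (sInf {m : ℕ | ∃ i ≤ h,
          ((t i).HasLabel NodeLabel.one ∨ (t i).HasLabel NodeLabel.two) ∧
            m = outerCost G u t i + innerCost G u t h i}) := by
  have hverts : (t h).verts = S ∪ K ∪ R := hH.verts_eq (ht.step h le_rfl)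
  have hu : u ∈ S ∪ K ∪ R := hverts ▸ ht.mem_verts h.le_succ
  have hK : K.Nontrivial := Set.one_lt_ncard_iff_nontrivial.1 hH.spider.isSpiderBase.two_le
  have hne {i : ℕ} (hi : i ≤ h) : (t i).verts.Nontrivial :=
    hK.mono ((hverts ▸ by grind : K ⊆ (t h).verts).trans (ht.verts_subset hi h.le_succ))
  refine le_min ?_ (le_csInf ⟨_, h, le_rfl, .inr hH.label, rfl⟩ ?_)
  · have hlocal := hH.spider.minFill_induce_tail_le hG hu
    rw [← hverts] at hlocal
    exact (ht.minFill_addTail_le hG hT le_rfl (hne le_rfl)).trans (Nat.add_le_add_right hlocal _)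
  · rintro _ ⟨i, hi, -, rfl⟩
    rw [Nat.add_comm]
    exact (ht.minFill_addTail_le hG hT hi (hne hi)).trans
      (Nat.add_le_add_right (ht.minFill_induce_tail_le_innerCost hG hi) _)
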